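/- Let $\sigma_s\ge 0$, $\sigma_n>0$, $\sigma_{n_z}>0$ and $P$ be real numbers, and consider the state-dependent Gaussian channels $$Y(i)=X(i)+S(i)+N(i),\qquad Z(i)=X(i)+S(i)+N_z(i),$$ where the states $S(i)\sim\mathcal N(0,\sigma_s^2)$ are i.i.d., the noise pairs $(N(i),N_z(i))$ are i.i.d. with marginals $N(i)\sim\mathcal N(0,\sigma_n^2)$ and $N_z(i)\sim\mathcal N(0,\sigma_{n_z}^2)$ (with an arbitrary dependence between $N(i)$ and $N_z(i)$), and the noise is independent of $(S^n,X^n)$. For block length $n$ an encoder is a conditional distribution of $X^n=(X(1),\dots,X(n))$ given the whole sequence $S^n$. A pair $(R_a,R_l)$ of real numbers is called achievable if for every $\epsilon>0$ and all sufficiently large $n$ there is an encoder with $$\tfrac1n I(S^n;Y^n)\ge R_a-\epsilon,\qquad \tfrac1n I(S^n;Z^n)\le R_l+\epsilon,\qquad \tfrac1n\sum_{i=1}^n\mathbb E[X(i)^2]\le P+\epsilon.$$ (In particular every pair for which this holds with the exact constraint $\frac1n\sum_i\mathbb E[X(i)^2]\le P$ is achievable.) Mutual information is measured in bits and $\log$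 is to base $2$. Then for every achievable pair $(R_a,R_l)$ there exist $\rho\in[-1,1]$ and $\sigma_x\ge 0$ with $\sigma_x^2\le P$ such that both $$R_a\le\frac12\log\left(1+\frac{\sigma_s^2+\sigma_x^2+2\rho\sigma_s\sigma_x}{\sigma_n^2}\right)$$ and $$R_l\ge\frac12\log\left(1+\frac{\sigma_s^2+\rho^2\sigma_x^2+2\rho\sigma_s\sigma_x}{\sigma_{n_z}^2+\sigma_x^2(1-\rho^2)}\right).$$ -/

import Mathlib

open MeasureTheory ProbabilityTheory InformationTheory Filter
open scoped NNReal ENNReal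

noncomputable section

namespace StateAmplification

/-- Mutual information `I(A; B)`, in bits, of two random variables on `(Ω, μ)`: the relative entropy
of the joint law with respect to the product of the marginal laws. -/
def mutualInfo {Ω α β : Type*} [MeasurableSpace Ω] [MeasurableSpace α] [MeasurableSpace β]
    (μ : Measure Ω) (A : Ω → α) (B : Ω → β) : ℝ≥0∞ :=
  klDiv (μ.map fun ω => (A ω, B ω)) ((μ.map A).prod (μ.map B)) / ENNReal.ofReal (Real.log 2)

/-- Outcomes of `n` channel uses: `((sⁿ, xⁿ), (noise pairs))`, where the `i`-th noise pair consists
of Bob's noise and Eve's noise at time `i`. -/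
abbrev Outcome (n : ℕ) : Type := ((Fin n → ℝ) × (Fin n → ℝ)) × (Fin n → ℝ × ℝ)

/-- The state sequence `Sⁿ`. -/
def state {n : ℕ} (ω : Outcome n) : Fin n → ℝ := ω.1.1

/-- The channel input sequence `Xⁿ`. -/
def input {n : ℕ} (ω : Outcome n) : Fin n → ℝ := ω.1.2

/-- Bob's noise sequence `Nⁿ`. -/
def noiseBob {n : ℕ} (ω : Outcome n) : Fin n → ℝ := fun i => (ω.2 i).1

/-- Eve's noise sequence `N_zⁿ`. -/
def noiseEve {n : ℕ} (ω : Outcome n) : Fin n → ℝ := fun i => (ω.2 i).2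

/-- Bob's output `Y(i) = X(i) + S(i) + N(i)`. -/
def outBob {n : ℕ} (ω : Outcome n) : Fin n → ℝ :=
  fun i => input ω i + state ω i + noiseBob ω i

/-- Eve's output `Z(i) = X(i) + S(i) + N_z(i)`. -/
def outEve {n : ℕ} (ω : Outcome n) : Fin n → ℝ :=
  fun i => input ω i + state ω i + noiseEve ω i

/-- The law of `n` channel uses: the state is i.i.d. `N(0, σs²)`; the (possibly randomized) encoder
`W` draws the whole input `Xⁿ` from the whole state sequence `Sⁿ`; the noise pairs are i.i.d. with
law `ν`, independent of `(Sⁿ, Xⁿ)`. -/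
def systemLaw (σs : ℝ≥0) (ν : Measure (ℝ × ℝ)) {n : ℕ} (W : Kernel (Fin n → ℝ) (Fin n → ℝ)) :
    Measure (Outcome n) :=
  ((Measure.pi fun _ : Fin n => gaussianReal 0 (σs ^ 2)) ⊗ₘ W).prod
    (Measure.pi fun _ : Fin n => ν)

/-- `(Ra, Rl)` is an achievable (amplification, leakage) pair under power constraint `P`: for every
`ε > 0` and all sufficiently large `n` there is an encoder of block length `n` with
`I(Sⁿ; Yⁿ) / n ≥ Ra - ε`, `I(Sⁿ; Zⁿ) / n ≤ Rl + ε` and average input power at most `P + ε`. -/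
def Achievable (σs : ℝ≥0) (ν : Measure (ℝ × ℝ)) (P Ra Rl : ℝ) : Prop :=
  ∀ ε : ℝ, 0 < ε → ∀ᶠ n : ℕ in atTop,
    ∃ W : Kernel (Fin n → ℝ) (Fin n → ℝ), IsMarkovKernel W ∧
      ((Ra - ε : ℝ) : EReal) ≤ ((mutualInfo (systemLaw σs ν W) state outBob / n : ℝ≥0∞) : EReal) ∧
      ((mutualInfo (systemLaw σs ν W) state outEve / n : ℝ≥0∞) : EReal) ≤ ((Rl + ε : ℝ) : EReal) ∧
      (∀ i, Integrable (fun ω => input ω i ^ 2) (systemLaw σs ν W)) ∧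
      (1 / (n : ℝ)) * ∑ i, ∫ ω, input ω i ^ 2 ∂(systemLaw σs ν W) ≤ P + ε

end StateAmplification

end

/-! ### Relative entropy inequalities and Gaussian densities. -/

namespace StateAmplification

/-! For a fixed encoder only two numbers matter: the time-averaged input power `p` and the
time-averaged state-input correlation `c`. Put `σx² = p` and `ρ = c / (σs σx)`; Cauchy–Schwarz gives
`|ρ| ≤ 1`.

Bob: replacing the law of `Yⁿ` by i.i.d. `N(0, V)`, with `V` the average output power, and the state
by the pair `(Sⁿ, Xⁿ)`, can only increase the divergence. Given that pair the output is Gaussian, so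
the result is exactly `n/2 log (V / σn²)` (`klDiv_add_noise_le`).

Eve: the Donsker–Varadhan bound is applied with the log-likelihood ratio of `N(b Z, D)` against the
state law, where `b Z` is the best linear estimate of the state and `D` its average squared error.
This gives at least `n/2 log (σs² / D)` for any encoder (`le_klDiv_add_noise`).

The same Gaussian test laws serve all coordinates, so no single-letter or concavity argument is
needed. Finally, the slack `ε` is removed by compactness of the set of parameters `(ρ, σx)`. -/

/-- **Donsker–Varadhan inequality** for a normalized exponential. -/
theorem ofReal_integral_le_klDiv {α : Type*} [MeasurableSpace α] {μ ν : Measure α}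
    [IsProbabilityMeasure μ] [IsProbabilityMeasure ν] {f : α → ℝ} (hf : Measurable f)
    (hfμ : Integrable f μ) (hfν : ∫⁻ x, ENNReal.ofReal (Real.exp (f x)) ∂ν ≤ 1) :
    ENNReal.ofReal (∫ x, f x ∂μ) ≤ klDiv μ ν := by
  by_cases h : klDiv μ ν = ∞
  · simp [h]
  obtain ⟨hμν, hint⟩ := klDiv_ne_top_iff.mp h
  have hexp : Integrable (fun x => Real.exp (f x)) ν := by
    refine ⟨hf.exp.aestronglyMeasurable, ?_⟩
    rw [hasFiniteIntegral_iff_ofReal (ae_of_all _ fun x => (Real.exp_pos _).le)]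
    exact hfν.trans_lt ENNReal.one_lt_top
  have hle : ∫ x, Real.exp (f x) ∂ν ≤ 1 := by
    rw [integral_eq_lintegral_of_nonneg_ae (ae_of_all _ fun x => (Real.exp_pos _).le)
      hf.exp.aestronglyMeasurable]
    exact ENNReal.toReal_le_of_le_ofReal zero_le_one (by simpa using hfν)
  have hlog : Real.log (∫ x, Real.exp (f x) ∂ν) ≤ 0 :=
    Real.log_nonpos (integral_nonneg fun x => (Real.exp_pos _).le) hle
  have := isProbabilityMeasure_tilted hexp
  -- Tilting `ν` by `f` lowers the integrated log-likelihood ratio by `∫ f ∂μ` and adds the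
  -- log-normalizer, which is at most `0`; what remains is a nonnegative divergence.
  have h1 := integral_llr_tilted_right hμν hfμ hexp hint
  have h2 := integral_llr_add_sub_measure_univ_nonneg
    (hμν.trans (absolutelyContinuous_tilted hexp))
    (integrable_llr_tilted_right hμν hfμ hint hexp)
  rw [klDiv_of_ac_of_integrable hμν hint]
  apply ENNReal.ofReal_le_ofReal
  simp only [probReal_univ] at h2 ⊢
  linarith

/-- Relative entropy of a probability measure given by an exponential density. -/
theorem klDiv_eq_ofReal_integral_of_withDensity {α : Type*} [MeasurableSpace α] {μ ν : Measure α}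
    [IsProbabilityMeasure μ] [IsProbabilityMeasure ν] {f : α → ℝ} (hf : Measurable f)
    (hfμ : Integrable f μ) (h : μ = ν.withDensity fun x => ENNReal.ofReal (Real.exp (f x))) :
    klDiv μ ν = ENNReal.ofReal (∫ x, f x ∂μ) := by
  have hac : μ ≪ ν := h ▸ withDensity_absolutelyContinuous _ _
  have hllr : llr μ ν =ᵐ[μ] f := by
    refine hac.ae_le ?_
    have := Measure.rnDeriv_withDensity ν
      (f := fun x => ENNReal.ofReal (Real.exp (f x))) (by fun_prop)
    rw [← h] at this
    filter_upwards [this] with x hx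
    rw [llr, hx, ENNReal.toReal_ofReal (Real.exp_pos _).le, Real.log_exp]
  rw [klDiv_of_ac_of_integrable hac (hfμ.congr hllr.symm), integral_congr_ae hllr]
  simp

/-- Replacing the law of `B` by any other law can only increase the relative entropy of the joint
law with respect to the product. -/
theorem klDiv_prod_map_le {Ω α β : Type*} [MeasurableSpace Ω] [MeasurableSpace α]
    [MeasurableSpace β] [StandardBorelSpace α] [Nonempty α]
    {μ : Measure Ω} [IsProbabilityMeasure μ] {A : Ω → α} {B : Ω → β} (hA : Measurable A)
    (hB : Measurable B) (Q : Measure β) [IsProbabilityMeasure Q] :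
    klDiv (μ.map fun ω => (A ω, B ω)) ((μ.map A).prod (μ.map B)) ≤
      klDiv (μ.map fun ω => (A ω, B ω)) ((μ.map A).prod Q) := by
  have := Measure.isProbabilityMeasure_map (μ := μ) hA.aemeasurable
  have := Measure.isProbabilityMeasure_map (μ := μ) hB.aemeasurable
  have := Measure.isProbabilityMeasure_map (μ := μ) (hA.prodMk hB).aemeasurable
  have := Measure.isProbabilityMeasure_map (μ := μ) (hB.prodMk hA).aemeasurable
  have e1 : (μ.map fun ω => (A ω, B ω)) = (μ.map fun ω => (B ω, A ω)).map Prod.swap := by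
    rw [Measure.map_map measurable_swap (hB.prodMk hA)]; rfl
  have e2 : (μ.map fun ω => (B ω, A ω)) = (μ.map fun ω => (A ω, B ω)).map Prod.swap := by
    rw [Measure.map_map measurable_swap (hA.prodMk hB)]; rfl
  calc klDiv (μ.map fun ω => (A ω, B ω)) ((μ.map A).prod (μ.map B))
      ≤ klDiv (μ.map fun ω => (B ω, A ω)) ((μ.map B).prod (μ.map A)) := by
        rw [e1, ← Measure.prod_swap (μ := μ.map B)]
        exact klDiv_map_le _ _ measurable_swap
    _ ≤ klDiv (μ.map fun ω => (B ω, A ω)) (Q.prod (μ.map A)) := by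
        -- Chain rule: the right side exceeds the left by the divergence of the law of `B` from `Q`.
        -- The disintegration is over `B`, hence the swaps.
        rw [← compProd_map_condDistrib (X := B) hA.aemeasurable, ← Measure.compProd_const,
          ← Measure.compProd_const, klDiv_compProd_eq_add (ν := Q)]
        exact le_add_self
    _ ≤ klDiv (μ.map fun ω => (A ω, B ω)) ((μ.map A).prod Q) := by
        rw [e2, ← Measure.prod_swap (μ := μ.map A)]
        exact klDiv_map_le _ _ measurable_swap

/-- Data processing along `g × id`. It lets the state be replaced by the whole pair (state, input),
given which the output is Gaussian. -/
theorem klDiv_map_prod_fst_le {Ω α γ β : Type*} [MeasurableSpace Ω] [MeasurableSpace α]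
    [MeasurableSpace γ] [MeasurableSpace β] {μ : Measure Ω} [IsProbabilityMeasure μ]
    {A : Ω → α} {B : Ω → β} (hA : Measurable A) (hB : Measurable B) {g : α → γ} (hg : Measurable g)
    (Q : Measure β) [IsProbabilityMeasure Q] :
    klDiv (μ.map fun ω => (g (A ω), B ω)) ((μ.map fun ω => g (A ω)).prod Q) ≤
      klDiv (μ.map fun ω => (A ω, B ω)) ((μ.map A).prod Q) := by
  have := Measure.isProbabilityMeasure_map (μ := μ) hA.aemeasurable
  have := Measure.isProbabilityMeasure_map (μ := μ) (hA.prodMk hB).aemeasurable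
  have e1 : (μ.map fun ω => (g (A ω), B ω)) = (μ.map fun ω => (A ω, B ω)).map (Prod.map g id) := by
    rw [Measure.map_map (hg.prodMap measurable_id) (hA.prodMk hB)]; rfl
  have e2 : (μ.map fun ω => g (A ω)).prod Q = ((μ.map A).prod Q).map (Prod.map g id) := by
    rw [← Measure.map_prod_map _ _ hg measurable_id, Measure.map_map hg hA, Measure.map_id]; rfl
  rw [e1, e2]
  exact klDiv_map_le _ _ (hg.prodMap measurable_id)

theorem lintegral_pi_prod_eq_prod {ι : Type*} [Fintype ι] {X : ι → Type*}
    [∀ i, MeasurableSpace (X i)] (μ : ∀ i, Measure (X i)) [∀ i, IsProbabilityMeasure (μ i)]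
    {f : ∀ i, X i → ℝ≥0∞} (hf : ∀ i, Measurable (f i)) :
    ∫⁻ x, ∏ i, f i (x i) ∂(Measure.pi μ) = ∏ i, ∫⁻ x, f i x ∂(μ i) := by
  have h := lintegral_prod_eq_prod_lintegral_of_indepFun (μ := Measure.pi μ) Finset.univ
    (fun i (x : ∀ i, X i) => f i (x i)) (iIndepFun_pi fun i => (hf i).aemeasurable)
    (fun i => (hf i).comp (measurable_pi_apply i))
  rw [h]
  refine Finset.prod_congr rfl fun i _ => ?_
  exact (measurePreserving_eval μ i).lintegral_comp (hf i)

theorem pi_withDensity {ι : Type*} [Fintype ι] {X : ι → Type*}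
    [∀ i, MeasurableSpace (X i)] (μ : ∀ i, Measure (X i)) [∀ i, IsProbabilityMeasure (μ i)]
    {f : ∀ i, X i → ℝ≥0∞} (hf : ∀ i, Measurable (f i))
    [∀ i, SigmaFinite ((μ i).withDensity (f i))] :
    Measure.pi (fun i => (μ i).withDensity (f i)) =
      (Measure.pi μ).withDensity fun x => ∏ i, f i (x i) := by
  refine Measure.pi_eq (μ := fun i => (μ i).withDensity (f i)) fun s hs => ?_
  rw [withDensity_apply _ (MeasurableSet.univ_pi hs),
    ← lintegral_indicator (MeasurableSet.univ_pi hs)]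
  have : (Set.univ.pi s).indicator (fun x => ∏ i, f i (x i)) =
      fun x => ∏ i, (s i).indicator (f i) (x i) := by
    ext x
    by_cases hx : x ∈ Set.univ.pi s
    · rw [Set.indicator_of_mem hx]
      exact Finset.prod_congr rfl fun i _ => by
        rw [Set.indicator_of_mem (hx i (Set.mem_univ i))]
    · rw [Set.indicator_of_notMem hx]
      simp only [Set.mem_univ_pi, not_forall] at hx
      obtain ⟨i, hi⟩ := hx
      exact (Finset.prod_eq_zero (Finset.mem_univ i) (Set.indicator_of_notMem hi _)).symm
  rw [this, lintegral_pi_prod_eq_prod μ fun i => (hf i).indicator (hs i)]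
  exact Finset.prod_congr rfl fun i _ => by
    rw [lintegral_indicator (hs i), withDensity_apply _ (hs i)]

/-- The log-likelihood ratio of `N(m, v)` with respect to `N(0, V)`. -/
noncomputable def gaussianLLR (V v : ℝ≥0) (m x : ℝ) : ℝ :=
  1 / 2 * Real.log (V / v) - (x - m) ^ 2 / (2 * v) + x ^ 2 / (2 * V)

@[fun_prop]
theorem measurable_gaussianLLR {α : Type*} [MeasurableSpace α] (V v : ℝ≥0) {m x : α → ℝ}
    (hm : Measurable m) (hx : Measurable x) : Measurable fun a => gaussianLLR V v (m a) (x a) := by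
  unfold gaussianLLR
  fun_prop

theorem gaussianReal_eq_withDensity {V v : ℝ≥0} (hV : V ≠ 0) (hv : v ≠ 0) (m : ℝ) :
    gaussianReal m v =
      (gaussianReal 0 V).withDensity fun x => ENNReal.ofReal (Real.exp (gaussianLLR V v m x)) := by
  rw [gaussianReal_of_var_ne_zero _ hV, gaussianReal_of_var_ne_zero _ hv,
    ← withDensity_mul _ (measurable_gaussianPDF _ _) (by fun_prop)]
  congr 1
  ext x
  have hV' : (0 : ℝ) < V := by positivity
  have hv' : (0 : ℝ) < v := by positivity
  rw [Pi.mul_apply, gaussianPDF, gaussianPDF, ← ENNReal.ofReal_mul (gaussianPDFReal_nonneg _ _ _)]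
  congr 1
  have hs : Real.exp (1 / 2 * Real.log (V / v)) = √(V / v) := by
    rw [Real.sqrt_eq_rpow, Real.rpow_def_of_pos (by positivity)]
    ring_nf
  have h1 : √(2 * Real.pi * V) = √(V / v) * √(2 * Real.pi * v) := by
    rw [← Real.sqrt_mul (by positivity)]
    congr 1
    field_simp
  simp only [gaussianPDFReal, gaussianLLR]
  rw [show 1 / 2 * Real.log (V / v) - (x - m) ^ 2 / (2 * v) + x ^ 2 / (2 * V) =
    1 / 2 * Real.log (V / v) + (-(x - m) ^ 2 / (2 * v) + x ^ 2 / (2 * V)) by ring,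
    Real.exp_add, hs, Real.exp_add, h1]
  have h2 : Real.exp (-(x - 0) ^ 2 / (2 * V)) * Real.exp (x ^ 2 / (2 * V)) = 1 := by
    rw [← Real.exp_add, sub_zero, neg_div, neg_add_cancel, Real.exp_zero]
  have h3 : √((V : ℝ) / v) ≠ 0 := by positivity
  have h4 : √(2 * Real.pi * v) ≠ 0 := by positivity
  calc (√(2 * Real.pi * v))⁻¹ * Real.exp (-(x - m) ^ 2 / (2 * v))
      = (√(2 * Real.pi * v))⁻¹ * Real.exp (-(x - m) ^ 2 / (2 * v)) *
        (Real.exp (-(x - 0) ^ 2 / (2 * V)) * Real.exp (x ^ 2 / (2 * V))) := by rw [h2, mul_one]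
    _ = _ := by field_simp

theorem pi_gaussianReal_eq_withDensity {n : ℕ} {V v : ℝ≥0} (hV : V ≠ 0) (hv : v ≠ 0)
    (m : Fin n → ℝ) :
    Measure.pi (fun i => gaussianReal (m i) v) =
      (Measure.pi fun _ : Fin n => gaussianReal 0 V).withDensity
        fun x => ENNReal.ofReal (Real.exp (∑ i, gaussianLLR V v (m i) (x i))) := by
  have (i : Fin n) : SigmaFinite ((gaussianReal 0 V).withDensity
      fun x => ENNReal.ofReal (Real.exp (gaussianLLR V v (m i) x))) := by
    rw [← gaussianReal_eq_withDensity hV hv]; infer_instance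
  simp_rw [gaussianReal_eq_withDensity hV hv]
  rw [pi_withDensity _ fun i => by fun_prop]
  simp_rw [Real.exp_sum, ENNReal.ofReal_prod_of_nonneg fun i _ => (Real.exp_pos _).le]

end StateAmplification

/-! ### Signals observed in Gaussian noise. -/

namespace StateAmplification

theorem mutualInfo_map {Ω Ω' α β : Type*} [MeasurableSpace Ω] [MeasurableSpace Ω']
    [MeasurableSpace α] [MeasurableSpace β] {μ : Measure Ω} {φ : Ω → Ω'} (hφ : Measurable φ)
    {A : Ω' → α} {B : Ω' → β} (hA : Measurable A) (hB : Measurable B) :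
    mutualInfo (μ.map φ) A B = mutualInfo μ (fun ω => A (φ ω)) (fun ω => B (φ ω)) := by
  unfold mutualInfo
  rw [Measure.map_map (hA.prodMk hB) hφ, Measure.map_map hA hφ, Measure.map_map hB hφ]
  rfl

section Noise

variable {α : Type*} [MeasurableSpace α] {π : Measure α}
  {n : ℕ} {v : ℝ≥0}

theorem integrable_sq_add_noise [IsProbabilityMeasure π] {g : α → ℝ} (hg : MemLp g 2 π) (b : ℝ) (i : Fin n) :
    Integrable (fun p : α × (Fin n → ℝ) => (g p.1 + b * p.2 i) ^ 2)
      (π.prod (Measure.pi fun _ : Fin n => gaussianReal 0 v)) := by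
  have h1 : MemLp (fun p : α × (Fin n → ℝ) => g p.1) 2
      (π.prod (Measure.pi fun _ : Fin n => gaussianReal 0 v)) := hg.comp_fst _
  have h2 : MemLp (fun y : Fin n → ℝ => y i) 2 (Measure.pi fun _ : Fin n => gaussianReal 0 v) :=
    (memLp_id_gaussianReal' 2 (by simp)).comp_measurePreserving
      (measurePreserving_eval (fun _ : Fin n => gaussianReal 0 v) i)
  have h3 : MemLp (fun p : α × (Fin n → ℝ) => p.2 i) 2
      (π.prod (Measure.pi fun _ : Fin n => gaussianReal 0 v)) := h2.comp_snd _
  exact (h1.add (h3.const_mul b)).integrable_sq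

theorem integral_sq_add_noise [IsProbabilityMeasure π] {g : α → ℝ} (hg : MemLp g 2 π) (b : ℝ) (i : Fin n) :
    ∫ p, (g p.1 + b * p.2 i) ^ 2 ∂(π.prod (Measure.pi fun _ : Fin n => gaussianReal 0 v)) =
      ∫ x, g x ^ 2 ∂π + b ^ 2 * v := by
  have hm : MemLp (fun y : ℝ => y) 2 (gaussianReal 0 v) := memLp_id_gaussianReal' 2 (by simp)
  have e1 : ∫ y : Fin n → ℝ, y i ∂(Measure.pi fun _ : Fin n => gaussianReal 0 v) = 0 := by
    rw [integral_eval (μ := fun _ : Fin n => gaussianReal 0 v), integral_id_gaussianReal]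
  have e2 : ∫ y : Fin n → ℝ, y i ^ 2 ∂(Measure.pi fun _ : Fin n => gaussianReal 0 v) = v := by
    rw [integral_comp_eval (μ := fun _ : Fin n => gaussianReal 0 v) (f := fun x => x ^ 2)
      (by fun_prop)]
    have := variance_fun_id_gaussianReal (μ := 0) (v := v)
    rwa [variance_eq_integral (by fun_prop), integral_id_gaussianReal,
      show (fun x : ℝ => (x - 0) ^ 2) = fun x => x ^ 2 by simp] at this
  have i1 : Integrable (fun y : Fin n → ℝ => y i) (Measure.pi fun _ : Fin n => gaussianReal 0 v) :=
    integrable_comp_eval (μ := fun _ : Fin n => gaussianReal 0 v) (f := fun x => x)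
      (hm.integrable (by norm_num))
  have i2 : Integrable (fun y : Fin n → ℝ => y i ^ 2)
      (Measure.pi fun _ : Fin n => gaussianReal 0 v) :=
    integrable_comp_eval (μ := fun _ : Fin n => gaussianReal 0 v) (f := fun x => x ^ 2)
      hm.integrable_sq
  have j1 := (hg.integrable_sq).comp_fst (Measure.pi fun _ : Fin n => gaussianReal 0 v)
  have j2 := ((hg.integrable (by norm_num)).mul_prod i1).const_mul (2 * b)
  have j3 := (i2.comp_snd π).const_mul (b ^ 2)
  have j12 : Integrable (fun p : α × (Fin n → ℝ) => g p.1 ^ 2 + 2 * b * (g p.1 * p.2 i))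
      (π.prod (Measure.pi fun _ : Fin n => gaussianReal 0 v)) := j1.add j2
  calc _ = ∫ p : α × (Fin n → ℝ), (g p.1 ^ 2 + 2 * b * (g p.1 * p.2 i) + b ^ 2 * p.2 i ^ 2)
        ∂(π.prod (Measure.pi fun _ : Fin n => gaussianReal 0 v)) := by
        congr 1; ext p; ring
    _ = _ := by
        rw [integral_add j12 j3, integral_add j1 j2, integral_const_mul, integral_const_mul,
          integral_prod_mul (f := g) (g := fun y : Fin n → ℝ => y i), e1,
          integral_fun_fst (f := fun x => g x ^ 2),
          integral_fun_snd (f := fun y : Fin n → ℝ => y i ^ 2), e2]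
        simp

/-- The integrand has the shape of `gaussianLLR` along the channel; the free coefficients `b`, `b'`
serve both the output density and the linear estimator. -/
theorem integrable_quadratic_noise [IsProbabilityMeasure π] {g h : α → ℝ} (hg : MemLp g 2 π) (hh : MemLp h 2 π)
    (c b d b' d' : ℝ) (i : Fin n) :
    Integrable (fun p : α × (Fin n → ℝ) =>
      c - (g p.1 + b * p.2 i) ^ 2 / d + (h p.1 + b' * p.2 i) ^ 2 / d')
      (π.prod (Measure.pi fun _ : Fin n => gaussianReal 0 v)) :=
  ((integrable_const _).sub ((integrable_sq_add_noise hg b i).div_const d)).add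
    ((integrable_sq_add_noise hh b' i).div_const d')

theorem integral_quadratic_noise [IsProbabilityMeasure π] {g h : α → ℝ} (hg : MemLp g 2 π) (hh : MemLp h 2 π)
    (c b d b' d' : ℝ) (i : Fin n) :
    ∫ p, (c - (g p.1 + b * p.2 i) ^ 2 / d + (h p.1 + b' * p.2 i) ^ 2 / d')
      ∂(π.prod (Measure.pi fun _ : Fin n => gaussianReal 0 v)) =
    c - (∫ x, g x ^ 2 ∂π + b ^ 2 * v) / d + (∫ x, h x ^ 2 ∂π + b' ^ 2 * v) / d' := by
  have i1 := (integrable_sq_add_noise (v := v) hg b i).div_const d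
  have i2 := (integrable_sq_add_noise (v := v) hh b' i).div_const d'
  have i3 : Integrable (fun p : α × (Fin n → ℝ) => c - (g p.1 + b * p.2 i) ^ 2 / d)
      (π.prod (Measure.pi fun _ : Fin n => gaussianReal 0 v)) := (integrable_const _).sub i1
  rw [integral_add i3 i2, integral_sub (integrable_const _) i1, integral_div, integral_div,
    integral_sq_add_noise hg, integral_sq_add_noise hh]
  simp

theorem pi_gaussianReal_map_add (m : Fin n → ℝ) :
    (Measure.pi fun _ : Fin n => gaussianReal 0 v).map (fun y i => m i + y i) =
      Measure.pi fun i => gaussianReal (m i) v := by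
  have := Measure.pi_map_pi (μ := fun _ : Fin n => gaussianReal 0 v)
    (f := fun i y => m i + y) (fun i => by fun_prop)
  rw [this]
  congr 1
  ext1 i
  rw [gaussianReal_map_const_add, zero_add]

/-- Fibrewise over the signal, the output is a product of Gaussians centred at `u a i`. -/
theorem map_add_noise_eq_withDensity [SFinite π] {V : ℝ≥0} (hV : V ≠ 0) (hv : v ≠ 0)
    {u : α → Fin n → ℝ} (hu : Measurable u) :
    (π.prod (Measure.pi fun _ : Fin n => gaussianReal 0 v)).map
        (fun p => (p.1, fun i => u p.1 i + p.2 i)) =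
      (π.prod (Measure.pi fun _ : Fin n => gaussianReal 0 V)).withDensity
        fun q => ENNReal.ofReal (Real.exp (∑ i, gaussianLLR V v (u q.1 i) (q.2 i))) := by
  refine Measure.ext_of_lintegral _ fun φ hφ => ?_
  rw [lintegral_map hφ (by fun_prop), lintegral_withDensity_eq_lintegral_mul _ (by fun_prop) hφ,
    lintegral_prod _ (by fun_prop), lintegral_prod _ (by fun_prop)]
  refine lintegral_congr fun a => ?_
  have h := pi_gaussianReal_eq_withDensity hV hv (u a)
  rw [← pi_gaussianReal_map_add] at h
  have h' := congrArg (fun μ => ∫⁻ y, φ (a, y) ∂μ) h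
  rw [lintegral_map (by fun_prop) (by fun_prop),
    lintegral_withDensity_eq_lintegral_mul _ (by fun_prop) (by fun_prop)] at h'
  exact h'

/-- Relative entropy of a signal observed in Gaussian noise, with respect to the signal paired with
independent Gaussian noise of variance `V`. -/
theorem klDiv_map_add_noise [IsProbabilityMeasure π] {V : ℝ≥0} (hV : V ≠ 0) (hv : v ≠ 0)
    {u : α → Fin n → ℝ} (hu : Measurable u) (hu2 : ∀ i, MemLp (fun a => u a i) 2 π) :
    klDiv ((π.prod (Measure.pi fun _ : Fin n => gaussianReal 0 v)).map
        (fun p => (p.1, fun i => u p.1 i + p.2 i)))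
      (π.prod (Measure.pi fun _ : Fin n => gaussianReal 0 V)) =
      ENNReal.ofReal (∑ i, (1 / 2 * Real.log (V / v) - 1 / 2 +
        (∫ a, u a i ^ 2 ∂π + v) / (2 * V))) := by
  have hmeas : Measurable fun p : α × (Fin n → ℝ) => (p.1, fun i => u p.1 i + p.2 i) := by fun_prop
  have := Measure.isProbabilityMeasure_map
    (μ := π.prod (Measure.pi fun _ : Fin n => gaussianReal 0 v)) hmeas.aemeasurable
  have hz : MemLp (fun _ : α => (0 : ℝ)) 2 π := memLp_const 0
  -- Here `x - m` is the noise alone, hence the zero signal; its mean contribution is `-1/2`.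
  have e (p : α × (Fin n → ℝ)) (i : Fin n) : gaussianLLR V v (u p.1 i) (u p.1 i + p.2 i) =
      1 / 2 * Real.log (V / v) - ((fun _ => (0 : ℝ)) p.1 + 1 * p.2 i) ^ 2 / (2 * v) +
        (u p.1 i + 1 * p.2 i) ^ 2 / (2 * V) := by
    simp [gaussianLLR]
  have i3 (i : Fin n) : Integrable (fun p : α × (Fin n → ℝ) =>
      gaussianLLR V v (u p.1 i) (u p.1 i + p.2 i))
      (π.prod (Measure.pi fun _ : Fin n => gaussianReal 0 v)) := by
    simp_rw [e]
    exact integrable_quadratic_noise hz (hu2 i) _ _ _ _ _ i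
  rw [klDiv_eq_ofReal_integral_of_withDensity (by fun_prop) ?_
    (map_add_noise_eq_withDensity hV hv hu)]
  · rw [integral_map hmeas.aemeasurable (Measurable.aestronglyMeasurable (by fun_prop)),
      integral_finsetSum _ fun i _ => i3 i]
    congr 1
    refine Finset.sum_congr rfl fun i _ => ?_
    simp_rw [e]
    rw [integral_quadratic_noise hz (hu2 i)]
    have : (v : ℝ) ≠ 0 := by exact_mod_cast hv
    simp
    field_simp
  · rw [integrable_map_measure (Measurable.aestronglyMeasurable (by fun_prop)) hmeas.aemeasurable]
    exact integrable_finsetSum _ fun i _ => i3 i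

/-- A Gaussian maximizes the information about a signal: upper bound through the output power. -/
theorem klDiv_add_noise_le [IsProbabilityMeasure π] {V : ℝ≥0} (hV : V ≠ 0) (hv : v ≠ 0) {γ : Type*} [MeasurableSpace γ]
    [StandardBorelSpace γ] [Nonempty γ] {S : α → γ} (hS : Measurable S)
    {u : α → Fin n → ℝ} (hu : Measurable u) (hu2 : ∀ i, MemLp (fun a => u a i) 2 π)
    (hVu : n * (V : ℝ) = ∑ i, (∫ a, u a i ^ 2 ∂π + v)) :
    klDiv ((π.prod (Measure.pi fun _ : Fin n => gaussianReal 0 v)).map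
        (fun p => (S p.1, fun i => u p.1 i + p.2 i)))
      (((π.prod (Measure.pi fun _ : Fin n => gaussianReal 0 v)).map fun p => S p.1).prod
        ((π.prod (Measure.pi fun _ : Fin n => gaussianReal 0 v)).map
          fun p i => u p.1 i + p.2 i)) ≤
      ENNReal.ofReal (n / 2 * Real.log (V / v)) := by
  refine (klDiv_prod_map_le (by fun_prop) (by fun_prop)
    (Measure.pi fun _ : Fin n => gaussianReal 0 V)).trans ?_
  refine (klDiv_map_prod_fst_le (A := Prod.fst) (by fun_prop) (by fun_prop) hS _).trans ?_
  rw [Measure.map_fst_prod, measure_univ, one_smul, klDiv_map_add_noise hV hv hu hu2]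
  apply ENNReal.ofReal_le_ofReal
  -- As `V` is the average output power, the power terms sum to `n/2` and cancel the `-1/2`s.
  rw [Finset.sum_add_distrib, ← Finset.sum_div, ← hVu]
  have : (V : ℝ) ≠ 0 := by exact_mod_cast hV
  simp
  field_simp
  linarith

/-- Lower bound on the information about an i.i.d. Gaussian source through the mean squared error
`D` of a linear estimator. -/
theorem le_klDiv_add_noise [IsProbabilityMeasure π] {t D : ℝ≥0} (ht : t ≠ 0) (hD : D ≠ 0) {S : α → Fin n → ℝ}
    (hS : Measurable S) (hSlaw : π.map S = Measure.pi fun _ : Fin n => gaussianReal 0 t)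
    {u : α → Fin n → ℝ} (hu : Measurable u) (hu2 : ∀ i, MemLp (fun a => u a i) 2 π) (b : ℝ)
    (hS2 : ∀ i, MemLp (fun a => S a i) 2 π) (hSt : ∀ i, ∫ a, S a i ^ 2 ∂π = t)
    (hDu : n * (D : ℝ) = ∑ i, (∫ a, (S a i - b * u a i) ^ 2 ∂π + b ^ 2 * v)) :
    ENNReal.ofReal (n / 2 * Real.log (t / D)) ≤
    klDiv ((π.prod (Measure.pi fun _ : Fin n => gaussianReal 0 v)).map
        (fun p => (S p.1, fun i => u p.1 i + p.2 i)))
      (((π.prod (Measure.pi fun _ : Fin n => gaussianReal 0 v)).map fun p => S p.1).prod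
        ((π.prod (Measure.pi fun _ : Fin n => gaussianReal 0 v)).map
          fun p i => u p.1 i + p.2 i)) := by
  set μ := π.prod (Measure.pi fun _ : Fin n => gaussianReal 0 v) with hμ
  have hmeas : Measurable fun p : α × (Fin n → ℝ) => (S p.1, fun i => u p.1 i + p.2 i) := by
    fun_prop
  have hmeas2 : Measurable fun (p : α × (Fin n → ℝ)) i => u p.1 i + p.2 i := by fun_prop
  have := Measure.isProbabilityMeasure_map (μ := μ) hmeas.aemeasurable
  have := Measure.isProbabilityMeasure_map (μ := μ) hmeas2.aemeasurable
  have hSμ : μ.map (fun p => S p.1) = Measure.pi fun _ : Fin n => gaussianReal 0 t := by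
    rw [← hSlaw, ← Function.comp_def S Prod.fst, ← Measure.map_map hS measurable_fst, hμ,
      Measure.map_fst_prod, measure_univ, one_smul]
  have e (p : α × (Fin n → ℝ)) (i : Fin n) :
      gaussianLLR t D (b * (u p.1 i + p.2 i)) (S p.1 i) = 1 / 2 * Real.log (t / D) -
        ((fun a => S a i - b * u a i) p.1 + (-b) * p.2 i) ^ 2 / (2 * D) +
        ((fun a => S a i) p.1 + 0 * p.2 i) ^ 2 / (2 * t) := by
    simp only [gaussianLLR]
    ring
  have hm (i : Fin n) : MemLp (fun a => S a i - b * u a i) 2 π :=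
    (hS2 i).sub ((hu2 i).const_mul b)
  have i3 (i : Fin n) : Integrable (fun p : α × (Fin n → ℝ) =>
      gaussianLLR t D (b * (u p.1 i + p.2 i)) (S p.1 i)) μ := by
    simp_rw [e]
    exact integrable_quadratic_noise (hm i) (hS2 i) _ _ _ _ _ i
  have hSprob : IsProbabilityMeasure (μ.map fun p => S p.1) := by rw [hSμ]; infer_instance
  -- The test function treats `N(b y, D)` as a guess for the posterior of each state symbol.
  have key := ofReal_integral_le_klDiv
    (μ := μ.map (fun p => (S p.1, fun i => u p.1 i + p.2 i)))
    (ν := (μ.map fun p => S p.1).prod (μ.map fun p i => u p.1 i + p.2 i))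
    (f := fun q => ∑ i, gaussianLLR t D (b * q.2 i) (q.1 i))
  rw [hSμ] at key ⊢
  refine le_trans (ENNReal.ofReal_le_ofReal ?_) (key (by fun_prop) ?_ ?_)
  · rw [integral_map hmeas.aemeasurable (Measurable.aestronglyMeasurable (by fun_prop)),
      integral_finsetSum _ fun i _ => i3 i]
    have (i : Fin n) : ∫ p, gaussianLLR t D (b * (u p.1 i + p.2 i)) (S p.1 i) ∂μ =
        1 / 2 * Real.log (t / D) + 1 / 2 -
          (∫ a, (S a i - b * u a i) ^ 2 ∂π + b ^ 2 * v) / (2 * D) := by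
      simp_rw [e]
      rw [integral_quadratic_noise (hm i) (hS2 i), hSt]
      have : (t : ℝ) ≠ 0 := by exact_mod_cast ht
      simp
      field_simp
      ring
    simp_rw [this]
    rw [Finset.sum_sub_distrib, ← Finset.sum_div, ← hDu]
    have : (D : ℝ) ≠ 0 := by exact_mod_cast hD
    simp
    field_simp
    linarith
  · rw [integrable_map_measure (Measurable.aestronglyMeasurable (by fun_prop)) hmeas.aemeasurable]
    exact integrable_finsetSum _ fun i _ => i3 i
  -- Integrating over the state first, each fixed `y` gives the total mass of a product Gaussian,
  -- whatever the output law.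
  · rw [lintegral_prod_symm _ (by fun_prop)]
    have (y : Fin n → ℝ) : ∫⁻ s, ENNReal.ofReal (Real.exp (∑ i, gaussianLLR t D (b * y i) (s i)))
        ∂(Measure.pi fun _ : Fin n => gaussianReal 0 t) = 1 := by
      have h := congrArg (fun μ => μ Set.univ)
        (pi_gaussianReal_eq_withDensity (n := n) ht hD fun i => b * y i)
      simp only [withDensity_apply _ MeasurableSet.univ, Measure.restrict_univ, measure_univ] at h
      exact h.symm
    simp_rw [this]
    simp

end Noise

end StateAmplification

/-! ### Bounds for one block through second moments. -/

namespace StateAmplification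

theorem systemLaw_map_noise {n : ℕ} (σs : ℝ≥0) {ν : Measure (ℝ × ℝ)} [IsProbabilityMeasure ν]
    (W : Kernel (Fin n → ℝ) (Fin n → ℝ)) [IsMarkovKernel W] {g : ℝ × ℝ → ℝ} (hg : Measurable g)
    {v : ℝ≥0} (hν : ν.map g = gaussianReal 0 v) :
    (systemLaw σs ν W).map (Prod.map id fun y i => g (y i)) =
      ((Measure.pi fun _ : Fin n => gaussianReal 0 (σs ^ 2)) ⊗ₘ W).prod
        (Measure.pi fun _ : Fin n => gaussianReal 0 v) := by
  have := Measure.pi_map_pi (μ := fun _ : Fin n => ν) (f := fun _ => g) fun _ => hg.aemeasurable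
  rw [systemLaw, ← Measure.map_prod_map _ _ measurable_id (by fun_prop), this, Measure.map_id, hν]

/-- Each mutual information sees only one marginal of the noise pair, so the dependence between the
two noises drops out. -/
theorem mutualInfo_systemLaw {n : ℕ} (σs : ℝ≥0) {ν : Measure (ℝ × ℝ)} [IsProbabilityMeasure ν]
    (W : Kernel (Fin n → ℝ) (Fin n → ℝ)) [IsMarkovKernel W] {g : ℝ × ℝ → ℝ} (hg : Measurable g)
    {v : ℝ≥0} (hν : ν.map g = gaussianReal 0 v) :
    mutualInfo (systemLaw σs ν W) state (fun ω i => input ω i + state ω i + g (ω.2 i)) =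
      mutualInfo (((Measure.pi fun _ : Fin n => gaussianReal 0 (σs ^ 2)) ⊗ₘ W).prod
        (Measure.pi fun _ : Fin n => gaussianReal 0 v)) (fun p => p.1.1)
        (fun p i => (p.1.2 i + p.1.1 i) + p.2 i) := by
  rw [← systemLaw_map_noise σs W hg hν, mutualInfo_map (by fun_prop) (by fun_prop) (by fun_prop)]
  rfl

theorem ofReal_nats_div {n : ℕ} (hn : n ≠ 0) (r : ℝ) :
    ENNReal.ofReal (n / 2 * Real.log r) / ENNReal.ofReal (Real.log 2) / n =
      ENNReal.ofReal (1 / 2 * Real.logb 2 r) := by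
  have hn' : (0 : ℝ) < n := by positivity
  rw [← ENNReal.ofReal_div_of_pos (Real.log_pos one_lt_two), ← ENNReal.ofReal_natCast,
    ← ENNReal.ofReal_div_of_pos hn', Real.logb]
  congr 1
  field_simp

/-- Second moments of state and input suffice to bound both information rates. -/
theorem exists_correlation {n : ℕ} (hn : n ≠ 0) {σs σn σnz : ℝ≥0} (hσn : 0 < σn)
    (hσnz : 0 < σnz) {π : Measure ((Fin n → ℝ) × (Fin n → ℝ))} [IsProbabilityMeasure π]
    (hπ : π.map Prod.fst = Measure.pi fun _ : Fin n => gaussianReal 0 (σs ^ 2))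
    (hx : ∀ i, Integrable (fun w => w.2 i ^ 2) π) :
    ∃ ρ : ℝ, -1 ≤ ρ ∧ ρ ≤ 1 ∧ ∃ σx : ℝ, 0 ≤ σx ∧
      σx ^ 2 = 1 / (n : ℝ) * ∑ i, ∫ w, w.2 i ^ 2 ∂π ∧
      mutualInfo (π.prod (Measure.pi fun _ : Fin n => gaussianReal 0 (σn ^ 2))) (fun p => p.1.1)
        (fun p i => (p.1.2 i + p.1.1 i) + p.2 i) / n ≤
        ENNReal.ofReal (1 / 2 * Real.logb 2
          (1 + ((σs : ℝ) ^ 2 + σx ^ 2 + 2 * ρ * σs * σx) / (σn : ℝ) ^ 2)) ∧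
      ENNReal.ofReal (1 / 2 * Real.logb 2
        (1 + ((σs : ℝ) ^ 2 + ρ ^ 2 * σx ^ 2 + 2 * ρ * σs * σx) /
          ((σnz : ℝ) ^ 2 + σx ^ 2 * (1 - ρ ^ 2)))) ≤
        mutualInfo (π.prod (Measure.pi fun _ : Fin n => gaussianReal 0 (σnz ^ 2)))
          (fun p => p.1.1) (fun p i => (p.1.2 i + p.1.1 i) + p.2 i) / n := by
  have hn' : (0 : ℝ) < n := by positivity
  have hmp (i : Fin n) : MeasurePreserving (fun w : (Fin n → ℝ) × (Fin n → ℝ) => w.1 i) π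
      (gaussianReal 0 (σs ^ 2)) :=
    (measurePreserving_eval (fun _ : Fin n => gaussianReal 0 (σs ^ 2)) i).comp
      ⟨measurable_fst, hπ⟩
  have hS2 (i : Fin n) : MemLp (fun w => w.1 i) 2 π :=
    (memLp_id_gaussianReal' 2 (by simp)).comp_measurePreserving (hmp i)
  have hX2 (i : Fin n) : MemLp (fun w => w.2 i) 2 π :=
    (memLp_two_iff_integrable_sq (by fun_prop)).mpr (hx i)
  have hSt (i : Fin n) : ∫ w, w.1 i ^ 2 ∂π = ((σs ^ 2 : ℝ≥0) : ℝ) := by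
    have h := variance_fun_id_gaussianReal (μ := 0) (v := σs ^ 2)
    rw [variance_eq_integral (by fun_prop), integral_id_gaussianReal, ← (hmp i).map_eq,
      integral_map (by fun_prop) (by fun_prop)] at h
    simpa using h
  have hquad (k l : ℝ) (i : Fin n) : ∫ w, (k * w.1 i + l * w.2 i) ^ 2 ∂π =
      k ^ 2 * σs ^ 2 + 2 * k * l * ∫ w, w.1 i * w.2 i ∂π + l ^ 2 * ∫ w, w.2 i ^ 2 ∂π := by
    have j1 := (hS2 i).integrable_sq.const_mul (k ^ 2)
    have j0 : Integrable (fun w => w.1 i * w.2 i) π := (hS2 i).integrable_mul (hX2 i)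
    have j2 := j0.const_mul (2 * k * l)
    have j3 := (hx i).const_mul (l ^ 2)
    have j12 : Integrable (fun w => k ^ 2 * w.1 i ^ 2 + 2 * k * l * (w.1 i * w.2 i)) π :=
      j1.add j2
    calc _ = ∫ w, (k ^ 2 * w.1 i ^ 2 + 2 * k * l * (w.1 i * w.2 i) + l ^ 2 * w.2 i ^ 2) ∂π := by
          congr 1; ext w; ring
      _ = _ := by
          rw [integral_add j12 j3, integral_add j1 j2, integral_const_mul, integral_const_mul,
            integral_const_mul, hSt]
          simp
  obtain ⟨c, hc⟩ : ∃ c : ℝ, c = 1 / (n : ℝ) * ∑ i, ∫ w, w.1 i * w.2 i ∂π := ⟨_, rfl⟩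
  generalize hp : 1 / (n : ℝ) * ∑ i, ∫ w, w.2 i ^ 2 ∂π = p
  have hsum (k l : ℝ) : ∑ i, ∫ w, (k * w.1 i + l * w.2 i) ^ 2 ∂π =
      n * (k ^ 2 * σs ^ 2 + 2 * k * l * c + l ^ 2 * p) := by
    simp_rw [hquad, Finset.sum_add_distrib, ← Finset.mul_sum]
    simp only [hc, ← hp, Finset.sum_const, Finset.card_univ, Fintype.card_fin, nsmul_eq_mul]
    field_simp
  have hnonneg (k l : ℝ) : 0 ≤ k ^ 2 * (σs : ℝ) ^ 2 + 2 * k * l * c + l ^ 2 * p := by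
    have h : 0 ≤ ∑ i, ∫ w, (k * w.1 i + l * w.2 i) ^ 2 ∂π :=
      Finset.sum_nonneg fun i _ => integral_nonneg fun w => sq_nonneg _
    rw [hsum] at h
    exact nonneg_of_mul_nonneg_right h hn'
  have hp0 : 0 ≤ p := by simpa using hnonneg 0 1
  have hcs : c ^ 2 ≤ (σs : ℝ) ^ 2 * p := by
    -- Cauchy–Schwarz, from the nonnegative quadratic `k ↦ hnonneg k 1`.
    have h := discrim_le_zero (a := (σs : ℝ) ^ 2) (b := 2 * c) (c := p) fun k => by
      have := hnonneg k 1
      linarith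
    rw [discrim] at h
    linarith
  have hsq : √p ^ 2 = p := Real.sq_sqrt hp0
  -- If `σs * √p = 0`, the quotient is `0` by convention, and Cauchy–Schwarz forces `c = 0`.
  have hρc : c / (σs * √p) * σs * √p = c := by
    rcases eq_or_ne ((σs : ℝ) * √p) 0 with h | h
    · have : c = 0 := by
        rw [← hsq, ← mul_pow, h] at hcs
        nlinarith
      simp [this]
    · rw [mul_assoc, div_mul_cancel₀ _ h]
  have hρ : (c / (σs * √p)) ^ 2 ≤ 1 := by
    rw [div_pow, mul_pow, hsq]
    exact div_le_one_of_le₀ hcs (by positivity)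
  have hu2 (i : Fin n) :
      MemLp (fun w : (Fin n → ℝ) × (Fin n → ℝ) => w.2 i + w.1 i) 2 π := (hX2 i).add (hS2 i)
  have hu (v : ℝ) : ∑ i, (∫ w, (w.2 i + w.1 i) ^ 2 ∂π + v) =
      n * (v + σs ^ 2 + 2 * c + p) := by
    have h := hsum 1 1
    have e (w : (Fin n → ℝ) × (Fin n → ℝ)) (i : Fin n) :
        w.2 i + w.1 i = 1 * w.1 i + 1 * w.2 i := by ring
    simp_rw [e, Finset.sum_add_distrib, h]
    simp
    ring
  have hV0 := hnonneg 1 1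
  have hσn' : (0 : ℝ) < σn := hσn
  have hσnz' : (0 : ℝ) < σnz := hσnz
  obtain ⟨ρ, hρdef⟩ : ∃ ρ, ρ = c / (σs * √p) := ⟨_, rfl⟩
  rw [← hρdef] at hρ hρc
  refine ⟨ρ, by nlinarith, by nlinarith, √p, Real.sqrt_nonneg _, hsq, ?_, ?_⟩
  · obtain ⟨V, hV⟩ : ∃ V : ℝ≥0, (V : ℝ) = σn ^ 2 + σs ^ 2 + 2 * c + p :=
      ⟨⟨σn ^ 2 + σs ^ 2 + 2 * c + p, by nlinarith⟩, rfl⟩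
    have hVpos : V ≠ 0 := by
      rw [← NNReal.coe_ne_zero, hV]
      nlinarith
    have h := klDiv_add_noise_le (π := π) (v := σn ^ 2) hVpos (by positivity)
      (S := Prod.fst) measurable_fst (u := fun w i => w.2 i + w.1 i) (by fun_prop) hu2
      (by rw [hV, hu]; simp)
    have hr : 1 + ((σs : ℝ) ^ 2 + √p ^ 2 + 2 * ρ * σs * √p) / (σn : ℝ) ^ 2 =
        (V : ℝ) / ((σn ^ 2 : ℝ≥0) : ℝ) := by
      rw [hV, hsq, show 2 * ρ * σs * √p = 2 * c by linear_combination 2 * hρc]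
      push_cast
      field_simp
      ring
    rw [hr, ← ofReal_nats_div hn]
    unfold mutualInfo
    gcongr
  -- Without state randomness `ρ = 0` and the claimed lower bound is `log 1 = 0`.
  · rcases eq_or_ne σs 0 with hs | hs
    · have : ρ = 0 := by simp [hρdef, hs]
      simp [this, hs]
    have hs' : (0 : ℝ) < σs := by positivity
    obtain ⟨Vz, hVz⟩ : ∃ Vz : ℝ, Vz = σnz ^ 2 + σs ^ 2 + 2 * c + p := ⟨_, rfl⟩
    have hVzpos : 0 < Vz := by nlinarith
    -- The determinant equals `σs² σnz² + (σs² p - c²)`.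
    have hdet : 0 < (σs : ℝ) ^ 2 * Vz - (σs ^ 2 + c) ^ 2 := by
      have : 0 < (σs : ℝ) ^ 2 * σnz ^ 2 := by positivity
      rw [hVz]
      nlinarith
    -- The least average squared error of a linear estimate of the state from Eve's output: `Vz` is
    -- her average power, `σs² + c` the average cross moment, and their quotient the optimal
    -- coefficient.
    obtain ⟨D, hD⟩ : ∃ D : ℝ≥0, (D : ℝ) = (σs ^ 2 * Vz - (σs ^ 2 + c) ^ 2) / Vz :=
      ⟨⟨(σs ^ 2 * Vz - (σs ^ 2 + c) ^ 2) / Vz, by positivity⟩, rfl⟩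
    have hDpos : D ≠ 0 := by
      rw [← NNReal.coe_ne_zero, hD]
      positivity
    have h := le_klDiv_add_noise (π := π) (v := σnz ^ 2) (t := σs ^ 2) (D := D) (by positivity)
      hDpos (S := Prod.fst) measurable_fst hπ (u := fun w i => w.2 i + w.1 i) (by fun_prop) hu2
      ((σs ^ 2 + c) / Vz) hS2 hSt (by
        have h := hsum (1 - (σs ^ 2 + c) / Vz) (-((σs ^ 2 + c) / Vz))
        have e (w : (Fin n → ℝ) × (Fin n → ℝ)) (i : Fin n) :
            w.1 i - (σs ^ 2 + c) / Vz * (w.2 i + w.1 i) =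
            (1 - (σs ^ 2 + c) / Vz) * w.1 i + -((σs ^ 2 + c) / Vz) * w.2 i := by ring
        simp_rw [e, Finset.sum_add_distrib, h, hD]
        simp only [Finset.sum_const, Finset.card_univ, Fintype.card_fin, nsmul_eq_mul]
        rw [← mul_add]
        congr 1
        push_cast
        field_simp
        rw [hVz]
        ring)
    have hden : 0 < (σnz : ℝ) ^ 2 + p * (1 - ρ ^ 2) := by
      have := mul_nonneg hp0 (sub_nonneg.mpr hρ)
      positivity
    have hρ2 : ρ ^ 2 * (σs ^ 2 * p) = c ^ 2 := by
      rw [← hρc, ← hsq]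
      ring_nf
      simp [hsq]
    have hr : 1 + ((σs : ℝ) ^ 2 + ρ ^ 2 * √p ^ 2 + 2 * ρ * σs * √p) /
        ((σnz : ℝ) ^ 2 + √p ^ 2 * (1 - ρ ^ 2)) = ((σs ^ 2 : ℝ≥0) : ℝ) / (D : ℝ) := by
      rw [hD, hsq, show 2 * ρ * σs * √p = 2 * c by linear_combination 2 * hρc]
      push_cast
      rw [div_div_eq_mul_div, one_add_div hden.ne', div_eq_div_iff hden.ne' hdet.ne', hVz]
      linear_combination (σnz ^ 2 + σs ^ 2 + 2 * c + p : ℝ) * hρ2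
    rw [hr, ← ofReal_nats_div hn]
    unfold mutualInfo
    gcongr

/-- The block bounds hold for every positive length, so a single good `n` suffices. -/
theorem Achievable.exists_approx {σs σn σnz : ℝ≥0} (hσn : 0 < σn) (hσnz : 0 < σnz) {P : ℝ}
    {ν : Measure (ℝ × ℝ)} [IsProbabilityMeasure ν]
    (hνn : ν.map Prod.fst = gaussianReal 0 (σn ^ 2))
    (hνnz : ν.map Prod.snd = gaussianReal 0 (σnz ^ 2))
    {Ra Rl : ℝ} (h : Achievable σs ν P Ra Rl) {ε : ℝ} (hε : 0 < ε) :
    ∃ ρ : ℝ, -1 ≤ ρ ∧ ρ ≤ 1 ∧ ∃ σx : ℝ, 0 ≤ σx ∧ σx ^ 2 ≤ P + ε ∧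
      Ra - ε ≤ 1 / 2 * Real.logb 2
        (1 + ((σs : ℝ) ^ 2 + σx ^ 2 + 2 * ρ * σs * σx) / (σn : ℝ) ^ 2) ∧
      1 / 2 * Real.logb 2
        (1 + ((σs : ℝ) ^ 2 + ρ ^ 2 * σx ^ 2 + 2 * ρ * σs * σx) /
          ((σnz : ℝ) ^ 2 + σx ^ 2 * (1 - ρ ^ 2))) ≤ Rl + ε := by
  obtain ⟨n, ⟨W, hW, hRa, hRl, hint, hpow⟩, hn⟩ := ((h ε hε).and (eventually_ne_atTop 0)).exists
  have hfst : (systemLaw σs ν W).map Prod.fst =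
      (Measure.pi fun _ : Fin n => gaussianReal 0 (σs ^ 2)) ⊗ₘ W := by
    rw [systemLaw, Measure.map_fst_prod, measure_univ, one_smul]
  have hint' (i : Fin n) : Integrable (fun w : (Fin n → ℝ) × (Fin n → ℝ) => w.2 i ^ 2)
      ((Measure.pi fun _ : Fin n => gaussianReal 0 (σs ^ 2)) ⊗ₘ W) := by
    rw [← hfst, integrable_map_measure (by fun_prop) (by fun_prop)]
    exact hint i
  obtain ⟨ρ, hρ1, hρ2, σx, hσx, hσx2, hB, hE⟩ := exists_correlation hn hσn hσnz
    (π := (Measure.pi fun _ : Fin n => gaussianReal 0 (σs ^ 2)) ⊗ₘ W)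
    (Measure.fst_compProd _ _) hint'
  rw [← mutualInfo_systemLaw σs W measurable_fst hνn] at hB
  rw [← mutualInfo_systemLaw σs W measurable_snd hνnz] at hE
  refine ⟨ρ, hρ1, hρ2, σx, hσx, ?_, ?_, ?_⟩
  · rw [hσx2, ← hfst]
    refine le_of_eq_of_le ?_ hpow
    congr 1
    refine Finset.sum_congr rfl fun i _ => ?_
    rw [integral_map (by fun_prop) (by fun_prop)]
    rfl
  -- `ENNReal.ofReal` truncates at `0`. Bob's upper bound must therefore be shown nonnegative; for
  -- Eve's lower bound truncation is harmless.
  · have hF : 0 ≤ 1 / 2 * Real.logb 2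
        (1 + ((σs : ℝ) ^ 2 + σx ^ 2 + 2 * ρ * σs * σx) / (σn : ℝ) ^ 2) := by
      have h1 : 0 ≤ (σs : ℝ) ^ 2 + σx ^ 2 + 2 * ρ * σs * σx := by
        nlinarith [sq_nonneg (σs - σx : ℝ), mul_nonneg (mul_nonneg σs.coe_nonneg hσx)
          (by linarith : 0 ≤ 1 + ρ)]
      have := Real.logb_nonneg one_lt_two
        (le_add_of_nonneg_right (a := (1 : ℝ)) (div_nonneg h1 (sq_nonneg (σn : ℝ))))
      positivity
    have h2 := hRa.trans (EReal.coe_ennreal_le_coe_ennreal_iff.mpr hB)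
    rwa [EReal.coe_ennreal_ofReal, max_eq_left hF, EReal.coe_le_coe_iff] at h2
  · have h2 := (EReal.coe_ennreal_le_coe_ennreal_iff.mpr hE).trans hRl
    rw [EReal.coe_ennreal_ofReal, EReal.coe_le_coe_iff] at h2
    exact (le_max_left _ _).trans h2

end StateAmplification

/-! ### Removing the slack by compactness. -/

theorem mainTheorem10 (σs σn σnz : ℝ≥0) (hσn : 0 < σn) (hσnz : 0 < σnz) (P : ℝ)
    (ν : Measure (ℝ × ℝ)) [IsProbabilityMeasure ν]
    (hνn : ν.map Prod.fst = gaussianReal 0 (σn ^ 2))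
    (hνnz : ν.map Prod.snd = gaussianReal 0 (σnz ^ 2))
    (Ra Rl : ℝ) (h : StateAmplification.Achievable σs ν P Ra Rl) :
    ∃ ρ : ℝ, -1 ≤ ρ ∧ ρ ≤ 1 ∧ ∃ σx : ℝ, 0 ≤ σx ∧ σx ^ 2 ≤ P ∧
      Ra ≤ 1 / 2 * Real.logb 2
        (1 + ((σs : ℝ) ^ 2 + σx ^ 2 + 2 * ρ * σs * σx) / (σn : ℝ) ^ 2) ∧
      1 / 2 * Real.logb 2
        (1 + ((σs : ℝ) ^ 2 + ρ ^ 2 * σx ^ 2 + 2 * ρ * σs * σx) /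
          ((σnz : ℝ) ^ 2 + σx ^ 2 * (1 - ρ ^ 2))) ≤ Rl := by

  obtain ⟨F, hF⟩ : ∃ F : ℝ × ℝ → ℝ, F = fun q => 1 / 2 * Real.logb 2
      (1 + ((σs : ℝ) ^ 2 + q.2 ^ 2 + 2 * q.1 * σs * q.2) / (σn : ℝ) ^ 2) := ⟨_, rfl⟩
  obtain ⟨G, hG⟩ : ∃ G : ℝ × ℝ → ℝ, G = fun q => 1 / 2 * Real.logb 2
      (1 + ((σs : ℝ) ^ 2 + q.1 ^ 2 * q.2 ^ 2 + 2 * q.1 * σs * q.2) /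
        ((σnz : ℝ) ^ 2 + q.2 ^ 2 * (1 - q.1 ^ 2))) := ⟨_, rfl⟩
  have happ (ε : ℝ) (hε : 0 < ε) := h.exists_approx hσn hσnz hνn hνnz hε
  have hσn' : (0 : ℝ) < σn := hσn
  have hσnz' : (0 : ℝ) < σnz := hσnz
  -- Restricting to `ε ≤ 1` keeps `σx` below `√(P + 1)`, so all approximate solutions lie in one
  -- compact set.
  set K : Set (ℝ × ℝ) := Set.Icc (-1) 1 ×ˢ Set.Icc 0 √(P + 1) with hK
  have hKmem {q : ℝ × ℝ} (hq : q ∈ K) : -1 ≤ q.1 ∧ q.1 ≤ 1 ∧ 0 ≤ q.2 :=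
    ⟨hq.1.1, hq.1.2, hq.2.1⟩
  have hFc : ContinuousOn F K := by
    rw [hF]
    refine continuousOn_const.mul (ContinuousOn.div_const (ContinuousOn.log (by fun_prop) ?_) _)
    intro q hq
    obtain ⟨h1, h2, h3⟩ := hKmem hq
    have : 0 ≤ (σs : ℝ) ^ 2 + q.2 ^ 2 + 2 * q.1 * σs * q.2 := by
      nlinarith [sq_nonneg (σs - q.2 : ℝ), mul_nonneg (mul_nonneg σs.coe_nonneg h3)
        (by linarith : 0 ≤ 1 + q.1)]
    positivity
  have hGc : ContinuousOn G K := by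
    have hden (q : ℝ × ℝ) (hq : q ∈ K) : 0 < (σnz : ℝ) ^ 2 + q.2 ^ 2 * (1 - q.1 ^ 2) := by
      obtain ⟨h1, h2, -⟩ := hKmem hq
      have : 0 ≤ 1 - q.1 ^ 2 := by nlinarith
      positivity
    rw [hG]
    refine continuousOn_const.mul (ContinuousOn.div_const (ContinuousOn.log
      (continuousOn_const.add (ContinuousOn.div (by fun_prop) (by fun_prop)
        fun q hq => (hden q hq).ne')) ?_) _)
    intro q hq
    have h1 := hden q hq
    change 1 + ((σs : ℝ) ^ 2 + q.1 ^ 2 * q.2 ^ 2 + 2 * q.1 * σs * q.2) /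
      ((σnz : ℝ) ^ 2 + q.2 ^ 2 * (1 - q.1 ^ 2)) ≠ 0
    have h2 : (σs : ℝ) ^ 2 + q.1 ^ 2 * q.2 ^ 2 + 2 * q.1 * σs * q.2 = (σs + q.1 * q.2) ^ 2 := by
      ring
    rw [h2]
    positivity
  have hmem (ε : ℝ) (hε : 0 < ε) (hε1 : ε ≤ 1) :
      ∃ q ∈ K, max (max (Ra - F q) (G q - Rl)) (q.2 ^ 2 - P) ≤ ε := by
    obtain ⟨ρ, h1, h2, σx, h3, h4, h5, h6⟩ := happ ε hε
    refine ⟨(ρ, σx), ⟨⟨h1, h2⟩, h3, Real.le_sqrt_of_sq_le (by linarith)⟩, ?_⟩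
    refine max_le (max_le ?_ ?_) ?_
    · rw [hF]; linarith
    · rw [hG]; linarith
    · simp only; linarith
  obtain ⟨q₁, hq₁, -⟩ := hmem 1 one_pos le_rfl
  -- The worst violation of the three constraints is continuous, so its minimum over `K` is
  -- attained; being at most every small `ε`, it is at most `0`.
  obtain ⟨q, hq, hmin⟩ := (isCompact_Icc.prod isCompact_Icc).exists_isMinOn ⟨q₁, hq₁⟩
    (f := fun q => max (max (Ra - F q) (G q - Rl)) (q.2 ^ 2 - P))
    (((continuousOn_const.sub hFc).sup (hGc.sub continuousOn_const)).sup (by fun_prop))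
  have hle : max (max (Ra - F q) (G q - Rl)) (q.2 ^ 2 - P) ≤ 0 := by
    refine le_of_forall_pos_le_add fun ε hε => ?_
    obtain ⟨q', hq', hle⟩ := hmem (min ε 1) (by positivity) (min_le_right _ _)
    rw [zero_add]
    exact ((isMinOn_iff.mp hmin q' hq').trans hle).trans (min_le_left _ _)
  obtain ⟨hle1, hle2⟩ := max_le_iff.mp hle
  obtain ⟨hle3, hle4⟩ := max_le_iff.mp hle1
  obtain ⟨h1, h2, h3⟩ := hKmem hq
  refine ⟨q.1, h1, h2, q.2, h3, by linarith, ?_, ?_⟩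
  · rw [hF] at hle3; linarith
  · rw [hG] at hle4; linarith
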